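/- Let $A$ be a real $3\times N$ matrix of rank $3$ whose top row is $(1,\dots,1)$, let $\hat A$ be the $2\times N$ matrix obtained by deleting the top row, and regard the columns $\hat\alpha_1,\dots,\hat\alpha_N$ of $\hat A$, not necessarily distinct, as a point configuration in $\mathbb{R}^2$. Let $B$ be a real Gale dual of $A$, i.e. a real $N\times m$ matrix, $m=N-3$, with $0\to\mathbb{R}^m\xrightarrow{B}\mathbb{R}^N\xrightarrow{A}\mathbb{R}^3\to 0$ exact, and let $\beta_1,\dots,\beta_N$ be its rows. The cuspidal form of $A$ is $$P_A(t)=\sum_{\sigma\subset\{1,\dots,N\},\ |\sigma|=2}|\hat A_\sigma|^2\prod_{k\in\sigma}\langle\beta_k,t\rangle,\qquad t=(t_1,\dots,t_m),$$ where $|\hat A_\sigma|$ is the minor of $\hat A$ on the columns in $\sigma$. Conventions. $A$ is a pyramid if there is a point $p$ of the configuration such that all points of the configuration different from $p$ lie in a proper affine subspace of $\mathbb{R}^2$. A conic is the zero set of $ax^2+bxy+cy^2+dx+ey+f$ with $(a,b,c)\neq(0,0,0)$; degenerate conics are allowed. A real conic is a parabola, a hyperbola or an ellipse if $b^2-4ac$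 is zero, positive or negative, respectively. A non-real parabola is given by complex coefficients with $b^2-4ac=0$ that are not a common complex multiple of real coefficients. The signature $s_A=(p,q;z)$ consists of the numbers of positive, negative and zero terms in a diagonalization of $P_A$ over $\mathbb{R}$. Then $P_A(t)$ is a quadratic form in the $m$ variables $t$, its rank is at most $3$, and: 1. $s_A=(0,0;m)$ if and only if $A$ is a pyramid. 2. $s_A=(1,0;m-1)$ if and only if $A$ is not a pyramid and is contained in a non-real parabola. If moreover the columns of $A$ are distinct and $m\ge 1$, then $s_A=(1,0;0)$ if and only if $A$ is contained in a non-real parabola. 3. $s_A=(0,1;m-1)$ if and only if $A$ is not a pyramid and is contained in a real parabola. 4. $s_A=(1,1;m-2)$ if and only if $A$ is contained in a hyperbola but in no parabola, real or non-real. 5. $s_A=(0,2;m-2)$ if and only if $A$ is contained in an ellipse but in no parabola, real or non-real. 6. $s_A=(1,2;m-3)$ in all other cases, that is, if and only if $A$ is not a pyramid and is contained in no non-real parabola, real parabola, hyperbola or ellipse. -/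

import Mathlib

/-- The matrix `Â` obtained from `A` by deleting its top row. -/
def hatMatrix {n N : ℕ} (A : Matrix (Fin (n + 1)) (Fin N) ℝ) : Matrix (Fin n) (Fin N) ℝ :=
  A.submatrix Fin.succ id

/-- A (real) Gale dual of `A`: a matrix `B` such that
`0 ⟶ ℝ^m ⟶ ℝ^N ⟶ ℝ^(1+n) ⟶ 0`, with maps `B` and `A`, is exact. -/
def IsGaleDual {n N m : ℕ} (A : Matrix (Fin (n + 1)) (Fin N) ℝ)
    (B : Matrix (Fin N) (Fin m) ℝ) : Prop :=
  Function.Injective B.mulVec ∧ Function.Exact B.mulVec A.mulVec ∧ Function.Surjective A.mulVec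

/-- The linear form `⟨β_k, t⟩`, where `β_k` is the `k`-th row of `B`. -/
noncomputable def rowForm {N m : ℕ} (B : Matrix (Fin N) (Fin m) ℝ) (k : Fin N) :
    MvPolynomial (Fin m) ℝ :=
  ∑ i, MvPolynomial.C (B k i) * MvPolynomial.X i

/-- The maximal minor of `Â` on the columns in the `n`-element set `σ`. -/
noncomputable def hatMinor {n N : ℕ} (A : Matrix (Fin (n + 1)) (Fin N) ℝ)
    (σ : {σ : Finset (Fin N) // σ.card = n}) : ℝ :=
  ((hatMatrix A).submatrix id (σ.1.orderEmbOfFin σ.2)).det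

/-- The cuspidal form `P_A(t) = ∑_σ |Â_σ|² ∏_{k ∈ σ} ⟨β_k, t⟩`, the sum being over all
`n`-element sets `σ` of columns. -/
noncomputable def cuspidalForm {n N m : ℕ} (A : Matrix (Fin (n + 1)) (Fin N) ℝ)
    (B : Matrix (Fin N) (Fin m) ℝ) : MvPolynomial (Fin m) ℝ :=
  ∑ σ : {σ : Finset (Fin N) // σ.card = n},
    MvPolynomial.C (hatMinor A σ ^ 2) * ∏ k ∈ σ.1, rowForm B k

theorem cuspidalForm_isHomogeneous {n N m : ℕ} (A : Matrix (Fin (n + 1)) (Fin N) ℝ)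
    (B : Matrix (Fin N) (Fin m) ℝ) : (cuspidalForm A B).IsHomogeneous n := by
  have hrow : ∀ k, (rowForm B k).IsHomogeneous 1 := fun k =>
    MvPolynomial.IsHomogeneous.sum _ _ _ fun i _ => by
      have h := (MvPolynomial.isHomogeneous_C (Fin m) (B k i)).mul
        (MvPolynomial.isHomogeneous_X ℝ i)
      rwa [Nat.zero_add] at h
  refine MvPolynomial.IsHomogeneous.sum _ _ _ fun σ _ => ?_
  have h := MvPolynomial.IsHomogeneous.prod σ.1 (rowForm B) (fun _ => 1) fun k _ => hrow k
  have h2 := (MvPolynomial.isHomogeneous_C (Fin m) (hatMinor A σ ^ 2)).mul h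
  have h3 : 0 + ∑ _k ∈ σ.1, 1 = n := by
    rw [Finset.sum_const, σ.2, smul_eq_mul, mul_one, Nat.zero_add]
  rwa [h3] at h2

theorem exists_bilinForm_of_degree_two {m : ℕ} (d : Fin m →₀ ℕ) (hd : d.degree = 2) :
    ∃ b : LinearMap.BilinForm ℝ (Fin m → ℝ), ∀ x : Fin m → ℝ,
      (d.prod fun i k => x i ^ k) = b x x := by
  have hne : d ≠ 0 := by rintro rfl; simp at hd
  obtain ⟨i, hi⟩ := Finsupp.ne_iff.mp hne
  have hle : Finsupp.single i 1 ≤ d := by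
    rw [Finsupp.single_le_iff]
    exact Nat.one_le_iff_ne_zero.mpr hi
  obtain ⟨e, rfl⟩ := exists_add_of_le hle
  have he : e.degree = 1 := by
    rw [map_add, Finsupp.degree_single] at hd
    omega
  obtain ⟨j, rfl⟩ : ∃ j, e = Finsupp.single j 1 := by
    have hne' : e ≠ 0 := by rintro rfl; simp at he
    obtain ⟨j, hj⟩ := Finsupp.ne_iff.mp hne'
    have hle' : Finsupp.single j 1 ≤ e := by
      rw [Finsupp.single_le_iff]
      exact Nat.one_le_iff_ne_zero.mpr hj
    obtain ⟨e', rfl⟩ := exists_add_of_le hle'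
    rw [map_add, Finsupp.degree_single] at he
    have : e' = 0 := (Finsupp.degree_eq_zero_iff e').mp (by omega)
    exact ⟨j, by simp [this]⟩
  refine ⟨LinearMap.BilinForm.linMulLin (LinearMap.proj i) (LinearMap.proj j), fun x => ?_⟩
  rw [Finsupp.prod_add_index' (by simp) (by intros; exact pow_add _ _ _)]
  simp

theorem exists_bilinForm_of_isHomogeneous_two {m : ℕ} (P : MvPolynomial (Fin m) ℝ)
    (hP : P.IsHomogeneous 2) : ∃ b : LinearMap.BilinForm ℝ (Fin m → ℝ),
      ∀ x, MvPolynomial.eval x P = b x x := by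
  classical
  have h : ∀ d : Fin m →₀ ℕ, ∃ b : LinearMap.BilinForm ℝ (Fin m → ℝ),
      d ∈ P.support → ∀ x : Fin m → ℝ, (d.prod fun i k => x i ^ k) = b x x := by
    intro d
    by_cases hd : d ∈ P.support
    · obtain ⟨b, hb⟩ := exists_bilinForm_of_degree_two d
        (by
          have h := hP (MvPolynomial.mem_support_iff.mp hd)
          rw [Finsupp.degree_eq_weight_one]
          exact h)
      exact ⟨b, fun _ => hb⟩
    · exact ⟨0, fun h => absurd h hd⟩
  choose b hb using h
  refine ⟨∑ d ∈ P.support, P.coeff d • b d, fun x => ?_⟩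
  rw [MvPolynomial.eval_eq]
  simp only [LinearMap.sum_apply, LinearMap.smul_apply, smul_eq_mul]
  refine Finset.sum_congr rfl fun d hd => ?_
  rw [← hb d hd x, Finsupp.prod]

/-- A homogeneous polynomial of degree two as a quadratic form `t ↦ P(t)` on `ℝ^m`. -/
noncomputable def toQuadForm {m : ℕ} (P : MvPolynomial (Fin m) ℝ) (hP : P.IsHomogeneous 2) :
    QuadraticForm ℝ (Fin m → ℝ) where
  toFun t := MvPolynomial.eval t P
  toFun_smul a x := by
    obtain ⟨b, hb⟩ := exists_bilinForm_of_isHomogeneous_two P hP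
    simp [hb, mul_assoc]
  exists_companion' := by
    obtain ⟨b, hb⟩ := exists_bilinForm_of_isHomogeneous_two P hP
    refine ⟨b + b.flip, fun x y => ?_⟩
    simp only [hb, map_add, LinearMap.add_apply]
    rw [show b.flip x y = b y x from rfl]
    ring

/-- For `n = 2`: the cuspidal form as a quadratic form on `ℝ^m`. -/
noncomputable def cuspidalQuadForm {N m : ℕ} (A : Matrix (Fin 3) (Fin N) ℝ)
    (B : Matrix (Fin N) (Fin m) ℝ) : QuadraticForm ℝ (Fin m → ℝ) :=
  toQuadForm (cuspidalForm (n := 2) A B) (cuspidalForm_isHomogeneous (n := 2) A B)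

/-- The signature `(p, q; z)` of a real quadratic form: the numbers of positive, of negative and
of zero terms in any diagonalization. -/
noncomputable def quadSignature {m : ℕ} (Q : QuadraticForm ℝ (Fin m → ℝ)) : ℕ × ℕ × ℕ :=
  (sigPos Q, sigNeg Q, Module.finrank ℝ (QuadraticMap.radical Q))

/-- `A` is a pyramid: all its points but one lie in a proper affine subspace. Here the points are
the columns of `Â`, and equal columns are the same point. -/
def IsPyramid {n N : ℕ} (A : Matrix (Fin (n + 1)) (Fin N) ℝ) : Prop :=
  ∃ j : Fin N, ∃ S : AffineSubspace ℝ (Fin n → ℝ), S ≠ ⊤ ∧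
    ∀ k : Fin N, (hatMatrix A).col k ≠ (hatMatrix A).col j → (hatMatrix A).col k ∈ S

/-- The polynomial `a x² + b x y + c y² + d x + e y + f` of a (possibly degenerate) plane conic. -/
structure ConicEq (K : Type*) [Field K] where
  a : K
  b : K
  c : K
  d : K
  e : K
  f : K
  quadratic_part_ne_zero : ¬ (a = 0 ∧ b = 0 ∧ c = 0)

namespace ConicEq

/-- The value of the polynomial at `(x, y)`. -/
def eval {K : Type*} [Field K] (C : ConicEq K) (x y : K) : K :=
  C.a * x ^ 2 + C.b * x * y + C.c * y ^ 2 + C.d * x + C.e * y + C.f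

/-- The discriminant `b² - 4ac`. -/
def disc {K : Type*} [Field K] (C : ConicEq K) : K := C.b ^ 2 - 4 * C.a * C.c

/-- A complex conic is real if its equation is a complex multiple of a real equation. -/
def IsReal (C : ConicEq ℂ) : Prop :=
  ∃ (z : ℂ) (R : ConicEq ℝ), C.a = z * R.a ∧ C.b = z * R.b ∧ C.c = z * R.c ∧
    C.d = z * R.d ∧ C.e = z * R.e ∧ C.f = z * R.f

end ConicEq

/-- All points `(A 1 k, A 2 k)` of the planar configuration lie on the real conic `C`. -/
def OnRealConic {N : ℕ} (A : Matrix (Fin 3) (Fin N) ℝ) (C : ConicEq ℝ) : Prop :=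
  ∀ k, C.eval (A 1 k) (A 2 k) = 0

def InRealParabola {N : ℕ} (A : Matrix (Fin 3) (Fin N) ℝ) : Prop :=
  ∃ C : ConicEq ℝ, C.disc = 0 ∧ OnRealConic A C

def InHyperbola {N : ℕ} (A : Matrix (Fin 3) (Fin N) ℝ) : Prop :=
  ∃ C : ConicEq ℝ, 0 < C.disc ∧ OnRealConic A C

def InEllipse {N : ℕ} (A : Matrix (Fin 3) (Fin N) ℝ) : Prop :=
  ∃ C : ConicEq ℝ, C.disc < 0 ∧ OnRealConic A C

/-- `A` lies on a complex parabola which is not real. -/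
def InNonRealParabola {N : ℕ} (A : Matrix (Fin 3) (Fin N) ℝ) : Prop :=
  ∃ C : ConicEq ℂ, C.disc = 0 ∧ ¬ C.IsReal ∧
    ∀ k, C.eval ((A 1 k : ℝ) : ℂ) ((A 2 k : ℝ) : ℂ) = 0

/-!
For `t ∈ ℝ^m` put `s = B t`, a general element of `ker A`. Since `|Â_σ|²` is symmetric in the two
columns and vanishes for equal columns, the cuspidal form is
`P_A(t) = u v - w²`, where `u = ∑ x_k² s_k`, `w = ∑ x_k y_k s_k`, `v = ∑ y_k² s_k`
(`cuspidalQuadForm_apply`). It is thus the pullback of a form of signature `(1, 2)` on `ℝ³` along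
`(u, w, v)`, which bounds its rank by `3`.

By exactness, a linear relation `a u + b w + c v = 0` holds if and only if
`a x² + b x y + c y²` agrees on the configuration with an affine function, that is, if and only if
the configuration lies on a conic with quadratic part `(a, b, c)` (`moment_relation_iff`).
Completing the square turns such a relation with `c ≠ 0` into
`P_A = (b² - 4ac) (u / 2c)² - (w + b u / 2c)²`, so the sign of the discriminant decides the
signature, once the linear forms occurring here are known to be independent:

* A second, non-proportional relation would give a pencil of conics through the configuration; over
  `ℂ` it contains a parabola. If there is none, the relation is unique, and a hyperbola gives
  `(1, 1)`, an ellipse `(0, 2)`, and the absence of any conic `(1, 2)`.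
* A real parabola makes `P_A` the negative of a square. A non-real parabola can be normalized to
  `(x + β y)² + ⋯` with `β ∉ ℝ`; its real and imaginary parts are two relations, and they make
  `P_A = (Im β)² v²`.
* In the last two cases `P_A` can only vanish if `p u + q w = p w + q v = 0` for some
  `(p, q) ≠ 0`. This means that multiplication by `ℓ = p x + q y` preserves the space spanned by
  `1, x, y` on the configuration, which happens exactly for pyramids (`isPyramid_of_relations`,
  `exists_relations_of_isPyramid`).

These cases exhaust all configurations and their signatures are distinct, so every implication
is an equivalence. For distinct points on a non-real parabola, write the equation in the complex
coordinate `ζ = x + β y` as `ζ² + a ζ + b ζ̄ + c = 0`. Eliminating `ζ̄` with the conjugate equation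
leaves a monic quartic in `ζ`, so `N ≤ 4` and `m ≤ 1`; on a real line `ζ̄` is affine in `ζ`, so at
most two of the points are collinear, and for `N = 4` there is no pyramid.
-/

/-! ### Signatures of sums and differences of squares -/

open Module in
theorem sigPos_comp_of_surjective {E F : Type*} [AddCommGroup E] [Module ℝ E]
    [FiniteDimensional ℝ E] [AddCommGroup F] [Module ℝ F] [FiniteDimensional ℝ F]
    (Q : QuadraticForm ℝ F) (f : E →ₗ[ℝ] F) (hf : Function.Surjective f) :
    sigPos (Q.comp f) = sigPos Q := by
  apply le_antisymm
  · obtain ⟨V, hV, hpos⟩ := exists_finrank_eq_sigPos_and_posDef (Q.comp f)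
    have hinj : ∀ x ∈ V, f x = 0 → x = 0 := by
      intro x hx h0
      by_contra hne
      have := hpos ⟨x, hx⟩ (by simpa using hne)
      simp [QuadraticMap.restrict_apply, h0] at this
    have hdim : finrank ℝ (LinearMap.range (f.domRestrict V)) = finrank ℝ V :=
      LinearMap.finrank_range_of_inj ((injective_iff_map_eq_zero _).mpr fun x hx =>
        Subtype.ext (hinj x x.2 hx))
    rw [← hV, ← hdim]
    apply le_sigPos_of_posDef
    rintro ⟨_, x, rfl⟩ hne
    exact hpos x (by rintro rfl; simp at hne)
  · obtain ⟨V, hV, hpos⟩ := exists_finrank_eq_sigPos_and_posDef Q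
    obtain ⟨g, hg⟩ := f.exists_rightInverse_of_surjective (LinearMap.range_eq_top.mpr hf)
    have hfg : ∀ x, f (g x) = x := fun x => LinearMap.congr_fun hg x
    have hinj : Function.Injective g := Function.LeftInverse.injective hfg
    have hdim : finrank ℝ (LinearMap.range (g.domRestrict V)) = finrank ℝ V :=
      LinearMap.finrank_range_of_inj (hinj.comp Subtype.val_injective)
    rw [← hV, ← hdim]
    apply le_sigPos_of_posDef
    rintro ⟨_, x, rfl⟩ hne
    have := hpos x (by rintro rfl; simp at hne)
    simpa [QuadraticMap.restrict_apply, hfg] using this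

/-- A form written as a difference of sums of squares of jointly independent linear forms has the
signature that can be read off: it is the pullback of a diagonal form along a surjection. -/
theorem quadSignature_eq_of_squares {m p q : ℕ} (Q : QuadraticForm ℝ (Fin m → ℝ))
    (l : Fin p → (Fin m → ℝ) →ₗ[ℝ] ℝ) (l' : Fin q → (Fin m → ℝ) →ₗ[ℝ] ℝ)
    (hind : ∀ (c : Fin p → ℝ) (c' : Fin q → ℝ),
      (∀ t, ∑ i, c i * l i t + ∑ j, c' j * l' j t = 0) → c = 0 ∧ c' = 0)
    (hQ : ∀ t, Q t = ∑ i, l i t ^ 2 - ∑ j, l' j t ^ 2) :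
    quadSignature Q = (p, q, m - (p + q)) := by
  set f : (Fin m → ℝ) →ₗ[ℝ] (Fin p ⊕ Fin q → ℝ) := LinearMap.pi (Sum.elim l l') with hfdef
  have hf : Function.Surjective f := by
    rw [← LinearMap.range_eq_top]
    by_contra hne
    obtain ⟨φ, hφ, hle⟩ := (LinearMap.range f).exists_le_ker_of_lt_top (lt_top_iff_ne_top.mpr hne)
    apply hφ
    have key : ∀ x, φ x = ∑ i, x i * φ (Pi.single i 1) := fun x => by
      conv_lhs => rw [← Finset.univ_sum_single x, map_sum]
      refine Finset.sum_congr rfl fun i _ => ?_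
      rw [show (Pi.single i (x i) : Fin p ⊕ Fin q → ℝ) = x i • Pi.single i 1 by
        rw [← Pi.single_smul, smul_eq_mul, mul_one], map_smul, smul_eq_mul]
    obtain ⟨h1, h2⟩ := hind (fun i => φ (Pi.single (Sum.inl i) 1))
      (fun j => φ (Pi.single (Sum.inr j) 1)) fun t => by
        have h0 : φ (f t) = 0 := hle (LinearMap.mem_range_self f t)
        rw [key, Fintype.sum_sum_type] at h0
        simpa [hfdef, mul_comm] using h0
    ext i
    rcases i with i | i
    · simpa using congrFun h1 i
    · simpa using congrFun h2 i
  -- The form is the pullback along `f` of the diagonal form with `p` weights `1`, `q` weights `-1`.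
  set w : Fin p ⊕ Fin q → ℝ := Sum.elim 1 (-1) with hw
  have hQf : Q = (QuadraticMap.weightedSumSquares ℝ w).comp f := by
    ext t
    rw [hQ, QuadraticMap.comp_apply, QuadraticMap.weightedSumSquares_apply, Fintype.sum_sum_type]
    simp [hw, hfdef, pow_two, sub_eq_add_neg]
  have hp : sigPos Q = p := by
    rw [hQf, sigPos_comp_of_surjective _ _ hf, QuadraticForm.sigPos_weightedSumSquares,
      show {i | 0 < w i} = Set.range Sum.inl by ext (i | i) <;> simp [hw, zero_le_one],
      Set.ncard_range_of_injective Sum.inl_injective]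
    simp
  have hq : sigNeg Q = q := by
    have hneg : -Q = (-QuadraticMap.weightedSumSquares ℝ w).comp f := by
      rw [hQf]; ext t; simp
    rw [← sigPos_neg, hneg, sigPos_comp_of_surjective _ _ hf, sigPos_neg,
      QuadraticForm.sigNeg_weightedSumSquares,
      show {i | w i < 0} = Set.range Sum.inr by ext (i | i) <;> simp [hw, zero_le_one],
      Set.ncard_range_of_injective Sum.inr_injective]
    simp
  have hsum := QuadraticForm.sigPos_add_sigNeg_add_radical (Q := Q)
  rw [Module.finrank_fin_fun, hp, hq] at hsum
  rw [quadSignature, hp, hq]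
  congr 2
  omega

/-! ### The cuspidal form as `u v - w²` -/

/-- The linear form `t ↦ ∑ k, g k * (B t) k`: the pairing of a function `g` on the configuration
with the element `B t` of the kernel of `A`. -/
noncomputable def galePairing {N m : ℕ} (B : Matrix (Fin N) (Fin m) ℝ) (g : Fin N → ℝ) :
    (Fin m → ℝ) →ₗ[ℝ] ℝ :=
  ∑ k, g k • (LinearMap.proj k ∘ₗ B.mulVecLin)

theorem galePairing_apply {N m : ℕ} (B : Matrix (Fin N) (Fin m) ℝ) (g : Fin N → ℝ)
    (t : Fin m → ℝ) : galePairing B g t = ∑ k, g k * B.mulVec t k := by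
  simp [galePairing]

/-- The linear form `t ↦ ∑ x_k² s_k` with `s = B t`. -/
noncomputable def momentXX {N m : ℕ} (A : Matrix (Fin 3) (Fin N) ℝ)
    (B : Matrix (Fin N) (Fin m) ℝ) : (Fin m → ℝ) →ₗ[ℝ] ℝ :=
  galePairing B fun k => A 1 k ^ 2

/-- The linear form `t ↦ ∑ x_k y_k s_k` with `s = B t`. -/
noncomputable def momentXY {N m : ℕ} (A : Matrix (Fin 3) (Fin N) ℝ)
    (B : Matrix (Fin N) (Fin m) ℝ) : (Fin m → ℝ) →ₗ[ℝ] ℝ :=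
  galePairing B fun k => A 1 k * A 2 k

/-- The linear form `t ↦ ∑ y_k² s_k` with `s = B t`. -/
noncomputable def momentYY {N m : ℕ} (A : Matrix (Fin 3) (Fin N) ℝ)
    (B : Matrix (Fin N) (Fin m) ℝ) : (Fin m → ℝ) →ₗ[ℝ] ℝ :=
  galePairing B fun k => A 2 k ^ 2

theorem eval_rowForm {N m : ℕ} (B : Matrix (Fin N) (Fin m) ℝ) (k : Fin N) (t : Fin m → ℝ) :
    MvPolynomial.eval t (rowForm B k) = B.mulVec t k := by
  simp [rowForm, Matrix.mulVec, dotProduct]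

/-- A sum over two-element sets, listed increasingly, as a sum over increasing pairs. -/
theorem sum_card_two_eq {N : ℕ} (F : Fin N → Fin N → ℝ) :
    ∑ σ : {σ : Finset (Fin N) // σ.card = 2},
      F (σ.1.orderEmbOfFin σ.2 0) (σ.1.orderEmbOfFin σ.2 1) =
    ∑ p : Fin N × Fin N with p.1 < p.2, F p.1 p.2 := by
  have hpair : ∀ σ : {σ : Finset (Fin N) // σ.card = 2},
      σ.1 = {σ.1.orderEmbOfFin σ.2 0, σ.1.orderEmbOfFin σ.2 1} := fun σ => by
    ext a
    rw [← Finset.mem_coe, ← Finset.range_orderEmbOfFin σ.1 σ.2, Set.mem_range, Fin.exists_fin_two]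
    simp [eq_comm]
  have hlt : ∀ σ : {σ : Finset (Fin N) // σ.card = 2},
      σ.1.orderEmbOfFin σ.2 0 < σ.1.orderEmbOfFin σ.2 1 := fun σ =>
    (σ.1.orderEmbOfFin σ.2).strictMono (by decide)
  refine Finset.sum_bij (fun σ _ => (σ.1.orderEmbOfFin σ.2 0, σ.1.orderEmbOfFin σ.2 1))
    (fun σ _ => by simp) (fun σ _ τ _ h => ?_) (fun p hp => ?_) (fun _ _ => rfl)
  · rw [Prod.mk.injEq] at h
    exact Subtype.ext (by rw [hpair σ, hpair τ, h.1, h.2])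
  · obtain ⟨i, j⟩ := p
    have hij : i < j := by simpa using hp
    refine ⟨⟨{i, j}, Finset.card_pair hij.ne⟩, Finset.mem_univ _, ?_⟩
    have h1 := hpair ⟨{i, j}, Finset.card_pair hij.ne⟩
    have h2 := hlt ⟨{i, j}, Finset.card_pair hij.ne⟩
    dsimp only at h1 h2 ⊢
    generalize (Finset.orderEmbOfFin {i, j} _) (0 : Fin 2) = a at h1 h2 ⊢
    generalize (Finset.orderEmbOfFin {i, j} _) (1 : Fin 2) = b at h1 h2 ⊢
    have ha : a = i ∨ a = j := by
      have : a ∈ ({i, j} : Finset (Fin N)) := by rw [h1]; simp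
      simpa using this
    have hb : b = i ∨ b = j := by
      have : b ∈ ({i, j} : Finset (Fin N)) := by rw [h1]; simp
      simpa using this
    rcases ha with rfl | rfl <;> rcases hb with rfl | rfl
    · exact absurd h2 (lt_irrefl _)
    · rfl
    · exact absurd h2 hij.asymm
    · exact absurd h2 (lt_irrefl _)

/-- A symmetric function vanishing on the diagonal: the sum over increasing pairs is half of the
sum over all pairs. -/
theorem sum_lt_mul_two {N : ℕ} (F : Fin N → Fin N → ℝ) (hsymm : ∀ i j, F i j = F j i)
    (hdiag : ∀ i, F i i = 0) :
    2 * ∑ p : Fin N × Fin N with p.1 < p.2, F p.1 p.2 = ∑ i, ∑ j, F i j := by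
  have hswap : ∑ p : Fin N × Fin N with p.1 < p.2, F p.1 p.2 =
      ∑ p : Fin N × Fin N with p.2 < p.1, F p.1 p.2 :=
    Finset.sum_bij (fun p _ => p.swap) (by simp) (by simp)
      (fun p hp => ⟨p.swap, by simpa using hp, by simp⟩) (fun p _ => hsymm _ _)
  have hall : ∀ p : Fin N × Fin N, F p.1 p.2 =
      (if p.1 < p.2 then F p.1 p.2 else 0) + (if p.2 < p.1 then F p.1 p.2 else 0) := by
    rintro ⟨i, j⟩
    rcases lt_trichotomy i j with h | h | h
    · simp [h, h.asymm]
    · simp [h, hdiag]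
    · simp [h, h.asymm]
  symm
  rw [← Fintype.sum_prod_type' F, Finset.sum_congr rfl fun p _ => hall p,
    Finset.sum_add_distrib, ← Finset.sum_filter, ← Finset.sum_filter, ← hswap, two_mul]

theorem cuspidalQuadForm_apply {N m : ℕ} (A : Matrix (Fin 3) (Fin N) ℝ)
    (B : Matrix (Fin N) (Fin m) ℝ) (t : Fin m → ℝ) :
    cuspidalQuadForm A B t = momentXX A B t * momentYY A B t - momentXY A B t ^ 2 := by
  set s := B.mulVec t with hs
  set F : Fin N → Fin N → ℝ := fun i j =>
    (A 1 i * A 2 j - A 1 j * A 2 i) ^ 2 * (s i * s j) with hF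
  have h1 : cuspidalQuadForm A B t = ∑ σ : {σ : Finset (Fin N) // σ.card = 2},
      F (σ.1.orderEmbOfFin σ.2 0) (σ.1.orderEmbOfFin σ.2 1) := by
    change MvPolynomial.eval t (cuspidalForm (n := 2) A B) = _
    rw [cuspidalForm, map_sum]
    refine Finset.sum_congr rfl fun σ _ => ?_
    have hprod : ∏ k ∈ σ.1, s k =
        s (σ.1.orderEmbOfFin σ.2 0) * s (σ.1.orderEmbOfFin σ.2 1) := by
      conv_lhs => rw [← Finset.image_orderEmbOfFin_univ σ.1 σ.2]
      rw [Finset.prod_image fun _ _ _ _ h => (σ.1.orderEmbOfFin σ.2).injective h,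
        Fin.prod_univ_two]
    simp only [map_mul, map_prod, MvPolynomial.eval_C, eval_rowForm, ← hs, hprod, hF, hatMinor,
      Matrix.det_fin_two, hatMatrix, Matrix.submatrix_apply, id]
    rfl
  have h2 := sum_lt_mul_two F (fun i j => by simp only [hF]; ring) (fun i => by simp [hF])
  have h3 : ∑ i, ∑ j, F i j =
      2 * (momentXX A B t * momentYY A B t - momentXY A B t ^ 2) := by
    have e1 : ∀ f g : Fin N → ℝ, (∑ i, f i) * ∑ j, g j = ∑ i, ∑ j, f i * g j := fun f g =>
      Finset.sum_mul_sum _ _ _ _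
    have e2 : momentXX A B t * momentYY A B t = momentYY A B t * momentXX A B t := mul_comm _ _
    rw [two_mul, sub_add_sub_comm]
    nth_rw 2 [e2]
    simp only [momentXX, momentXY, momentYY, galePairing_apply, pow_two, e1, ← hs,
      ← Finset.sum_add_distrib, ← Finset.sum_sub_distrib]
    refine Finset.sum_congr rfl fun i _ => Finset.sum_congr rfl fun j _ => ?_
    simp only [hF]; ring
  rw [h1, sum_card_two_eq F]
  linarith

theorem rank_toMatrix'_cuspidalQuadForm_le {N m : ℕ} (A : Matrix (Fin 3) (Fin N) ℝ)
    (B : Matrix (Fin N) (Fin m) ℝ) :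
    (QuadraticForm.toMatrix' (cuspidalQuadForm A B)).rank ≤ 3 := by
  let Q₀ : QuadraticForm ℝ (Fin 3 → ℝ) :=
    QuadraticMap.linMulLin (LinearMap.proj 0) (LinearMap.proj 2) -
      QuadraticMap.linMulLin (LinearMap.proj 1) (LinearMap.proj 1)
  have h : cuspidalQuadForm A B =
      Q₀.comp (LinearMap.pi ![momentXX A B, momentXY A B, momentYY A B]) := by
    ext t
    simp [Q₀, cuspidalQuadForm_apply, pow_two]
  rw [h, QuadraticForm.toMatrix'_comp, Matrix.mul_assoc]
  refine (Matrix.rank_mul_le_left _ _).trans ?_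
  simpa using Matrix.rank_le_width (LinearMap.toMatrix'
    (LinearMap.pi ![momentXX A B, momentXY A B, momentYY A B])).transpose

/-! ### Relations between the moments and conics -/

/-- No nonzero affine function vanishes on the whole configuration. -/
theorem affine_eq_zero {N m : ℕ} {A : Matrix (Fin 3) (Fin N) ℝ} {B : Matrix (Fin N) (Fin m) ℝ}
    (hones : ∀ k, A 0 k = 1) (hB : IsGaleDual (n := 2) A B) {d e f : ℝ}
    (h : ∀ k, d * A 1 k + e * A 2 k + f = 0) : d = 0 ∧ e = 0 ∧ f = 0 := by
  have key : ∀ y : Fin 3 → ℝ, f * y 0 + d * y 1 + e * y 2 = 0 := by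
    intro y
    obtain ⟨s, rfl⟩ := hB.2.2 y
    simp only [Matrix.mulVec, dotProduct, Finset.mul_sum, ← Finset.sum_add_distrib]
    refine Finset.sum_eq_zero fun k _ => ?_
    rw [hones]
    linear_combination s k * h k
  have h0 := key ![1, 0, 0]
  have h1 := key ![0, 1, 0]
  have h2 := key ![0, 0, 1]
  simp at h0 h1 h2
  exact ⟨h1, h2, h0⟩

/-- Functions on the configuration that annihilate `ker A = range B` are exactly the affine ones: a
linear form vanishing on `ker A` factors through `A`. -/
theorem galePairing_eq_zero_iff {N m : ℕ} {A : Matrix (Fin 3) (Fin N) ℝ}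
    {B : Matrix (Fin N) (Fin m) ℝ} (hones : ∀ k, A 0 k = 1) (hB : IsGaleDual (n := 2) A B)
    (g : Fin N → ℝ) :
    (∀ t, galePairing B g t = 0) ↔ ∃ d e f, ∀ k, g k + d * A 1 k + e * A 2 k + f = 0 := by
  constructor
  · intro h
    let φ : Module.Dual ℝ (Fin N → ℝ) := ∑ k, g k • LinearMap.proj k
    have hφ : φ ∈ (LinearMap.ker A.mulVecLin).dualAnnihilator := by
      rw [Submodule.mem_dualAnnihilator]
      intro s hs
      obtain ⟨t, rfl⟩ := (hB.2.1 s).mp hs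
      simpa [φ, galePairing_apply] using h t
    rw [← LinearMap.range_dualMap_eq_dualAnnihilator_ker] at hφ
    obtain ⟨ψ, hψ⟩ := hφ
    refine ⟨-ψ (Pi.single 1 1), -ψ (Pi.single 2 1), -ψ (Pi.single 0 1), fun k => ?_⟩
    have h1 := LinearMap.congr_fun hψ (Pi.single k 1)
    have h2 : φ (Pi.single k 1) = g k := by
      simp [φ, Pi.single_apply]
    have h3 : A.mulVecLin (Pi.single k 1) = Pi.single (0 : Fin 3) (1 : ℝ) +
        A 1 k • Pi.single (1 : Fin 3) (1 : ℝ) + A 2 k • Pi.single (2 : Fin 3) (1 : ℝ) := by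
      ext i
      fin_cases i <;> simp [hones]
    rw [h2, LinearMap.dualMap_apply, h3] at h1
    simp only [map_add, map_smul, smul_eq_mul] at h1
    linarith
  · rintro ⟨d, e, f, h⟩ t
    have hA : ∀ i, ∑ k, A i k * B.mulVec t k = 0 := fun i =>
      congrFun ((hB.2.1 (B.mulVec t)).mpr ⟨t, rfl⟩) i
    have h0 := hA 0
    simp only [hones, one_mul] at h0
    have : galePairing B g t = -(d * ∑ k, A 1 k * B.mulVec t k + e * ∑ k, A 2 k * B.mulVec t k +
        f * ∑ k, B.mulVec t k) := by
      rw [galePairing_apply, Finset.mul_sum, Finset.mul_sum, Finset.mul_sum,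
        ← Finset.sum_add_distrib, ← Finset.sum_add_distrib, ← Finset.sum_neg_distrib]
      exact Finset.sum_congr rfl fun k _ => by linear_combination B.mulVec t k * h k
    rw [this, hA, hA, h0]
    ring

/-- Linear relations between the three moments correspond to conics through the configuration. -/
theorem moment_relation_iff {N m : ℕ} {A : Matrix (Fin 3) (Fin N) ℝ}
    {B : Matrix (Fin N) (Fin m) ℝ} (hones : ∀ k, A 0 k = 1) (hB : IsGaleDual (n := 2) A B)
    (a b c : ℝ) :
    (∀ t, a * momentXX A B t + b * momentXY A B t + c * momentYY A B t = 0) ↔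
      ∃ d e f, ∀ k, a * A 1 k ^ 2 + b * A 1 k * A 2 k + c * A 2 k ^ 2 +
        d * A 1 k + e * A 2 k + f = 0 := by
  rw [← galePairing_eq_zero_iff hones hB
    fun k => a * A 1 k ^ 2 + b * A 1 k * A 2 k + c * A 2 k ^ 2]
  refine forall_congr' fun t => ?_
  simp only [momentXX, momentXY, momentYY, galePairing_apply, Finset.mul_sum,
    ← Finset.sum_add_distrib]
  refine Eq.congr_left (Finset.sum_congr rfl fun k _ => ?_)
  ring

/-! ### The form `u v - w²` under a linear relation -/

section QuadraticAlgebra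

variable {E : Type*} [AddCommGroup E] [Module ℝ E]

theorem mul_sub_sq_of_relation (u w v : E →ₗ[ℝ] ℝ) {a b c : ℝ} (hc : c ≠ 0)
    (h : ∀ t, a * u t + b * w t + c * v t = 0) (t : E) :
    u t * v t - w t ^ 2 =
      (b ^ 2 - 4 * a * c) * (u t / (2 * c)) ^ 2 - (w t + b / (2 * c) * u t) ^ 2 := by
  have hv : v t = -(a * u t + b * w t) / c := by
    field_simp
    linear_combination h t
  rw [hv]
  field_simp
  ring

/-- A relation of discriminant zero makes `u v - w²` the negative of a square. If that square
vanishes, there are two relations of the kind that characterizes pyramids. -/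
theorem exists_neg_square_of_parabola (u w v : E →ₗ[ℝ] ℝ) {a b c : ℝ}
    (h0 : ¬ (a = 0 ∧ b = 0 ∧ c = 0)) (hd : b ^ 2 - 4 * a * c = 0)
    (h : ∀ t, a * u t + b * w t + c * v t = 0) :
    ∃ l : E →ₗ[ℝ] ℝ, (∀ t, u t * v t - w t ^ 2 = -l t ^ 2) ∧
      (l = 0 → ∃ p q : ℝ, ¬ (p = 0 ∧ q = 0) ∧ (∀ t, p * u t + q * w t = 0) ∧
        ∀ t, p * w t + q * v t = 0) := by
  -- The statement is symmetric under exchanging `u` and `v`, so `c ≠ 0` may be assumed.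
  have main : ∀ (u v : E →ₗ[ℝ] ℝ) {a c : ℝ}, c ≠ 0 → b ^ 2 - 4 * a * c = 0 →
      (∀ t, a * u t + b * w t + c * v t = 0) →
      ∃ l : E →ₗ[ℝ] ℝ, (∀ t, u t * v t - w t ^ 2 = -l t ^ 2) ∧
        (l = 0 → ∃ p q : ℝ, ¬ (p = 0 ∧ q = 0) ∧ (∀ t, p * u t + q * w t = 0) ∧
          ∀ t, p * w t + q * v t = 0) := by
    intro u v a c hc hd h
    refine ⟨w + (b / (2 * c)) • u, fun t => ?_, fun hl => ?_⟩
    · rw [mul_sub_sq_of_relation u w v hc h t, hd]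
      simp
    · have h1 : ∀ t, b * u t + 2 * c * w t = 0 := fun t => by
        have := LinearMap.congr_fun hl t
        simp only [LinearMap.add_apply, LinearMap.smul_apply, smul_eq_mul,
          LinearMap.zero_apply] at this
        field_simp at this
        linear_combination this
      refine ⟨b, 2 * c, fun h => hc (by simpa using h.2), h1, fun t => ?_⟩
      have : 2 * c * (b * w t + 2 * c * v t) = 0 := by
        linear_combination 4 * c * h t - b * h1 t + u t * hd
      exact (mul_eq_zero.mp this).resolve_left (mul_ne_zero two_ne_zero hc)
  by_cases hc : c = 0
  · have hb : b = 0 := by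
      rw [hc] at hd
      exact pow_eq_zero_iff two_ne_zero |>.mp (by linarith)
    have ha : a ≠ 0 := fun ha => h0 ⟨ha, hb, hc⟩
    obtain ⟨l, hl, hz⟩ := main v u (a := c) (c := a) ha (by linear_combination hd)
      (fun t => by linear_combination h t)
    refine ⟨l, fun t => by rw [← hl t, mul_comm], fun h => ?_⟩
    obtain ⟨p, q, hpq, h1, h2⟩ := hz h
    exact ⟨q, p, fun h => hpq h.symm, fun t => by linear_combination h2 t,
      fun t => by linear_combination h1 t⟩
  · exact main u v hc hd h

end QuadraticAlgebra

section Signature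

variable {m : ℕ} {Q : QuadraticForm ℝ (Fin m → ℝ)} {u w v : (Fin m → ℝ) →ₗ[ℝ] ℝ}

theorem quadSignature_of_sq (l : (Fin m → ℝ) →ₗ[ℝ] ℝ) (hl : l ≠ 0) (hQ : ∀ t, Q t = l t ^ 2) :
    quadSignature Q = (1, 0, m - 1) := by
  refine quadSignature_eq_of_squares Q ![l] ![] (fun c c' h => ⟨?_, Subsingleton.elim _ _⟩)
    (fun t => by simp [hQ])
  obtain ⟨t, ht⟩ : ∃ t, l t ≠ 0 := by
    by_contra! h
    exact hl (LinearMap.ext h)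
  have := h t
  ext i
  fin_cases i
  simpa [ht] using this

theorem quadSignature_of_neg_sq (l : (Fin m → ℝ) →ₗ[ℝ] ℝ) (hl : l ≠ 0)
    (hQ : ∀ t, Q t = -l t ^ 2) : quadSignature Q = (0, 1, m - 1) := by
  refine quadSignature_eq_of_squares Q ![] ![l] (fun c c' h => ⟨Subsingleton.elim _ _, ?_⟩)
    (fun t => by simp [hQ])
  obtain ⟨t, ht⟩ : ∃ t, l t ≠ 0 := by
    by_contra! h
    exact hl (LinearMap.ext h)
  have := h t
  ext i
  fin_cases i
  simpa [ht] using this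

theorem quadSignature_of_sq_sub_sq (l l' : (Fin m → ℝ) →ₗ[ℝ] ℝ)
    (hind : ∀ p q : ℝ, (∀ t, p * l t + q * l' t = 0) → p = 0 ∧ q = 0)
    (hQ : ∀ t, Q t = l t ^ 2 - l' t ^ 2) : quadSignature Q = (1, 1, m - 2) := by
  refine quadSignature_eq_of_squares Q ![l] ![l'] (fun c c' h => ?_) (fun t => by simp [hQ])
  obtain ⟨h1, h2⟩ := hind (c 0) (c' 0) fun t => by simpa using h t
  constructor <;> ext i <;> fin_cases i <;> assumption

theorem quadSignature_of_neg_sq_sub_sq (l l' : (Fin m → ℝ) →ₗ[ℝ] ℝ)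
    (hind : ∀ p q : ℝ, (∀ t, p * l t + q * l' t = 0) → p = 0 ∧ q = 0)
    (hQ : ∀ t, Q t = -l t ^ 2 - l' t ^ 2) : quadSignature Q = (0, 2, m - 2) := by
  refine quadSignature_eq_of_squares Q ![] ![l, l']
    (fun c c' h => ⟨Subsingleton.elim _ _, ?_⟩) (fun t => by simp [hQ]; ring)
  obtain ⟨h1, h2⟩ := hind (c' 0) (c' 1) fun t => by simpa using h t
  ext i
  fin_cases i <;> assumption

theorem quadSignature_of_independent (hQ : ∀ t, Q t = u t * v t - w t ^ 2)
    (hind : ∀ a b c : ℝ, (∀ t, a * u t + b * w t + c * v t = 0) → a = 0 ∧ b = 0 ∧ c = 0) :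
    quadSignature Q = (1, 2, m - 3) := by
  refine quadSignature_eq_of_squares Q ![(1 / 2 : ℝ) • (u + v)] ![(1 / 2 : ℝ) • (u - v), w]
    (fun c c' h => ?_) (fun t => ?_)
  · obtain ⟨h1, h2, h3⟩ := hind ((c 0 + c' 0) / 2) (c' 1) ((c 0 - c' 0) / 2) fun t => by
      have := h t
      simp [Fin.sum_univ_two] at this
      linear_combination this
    constructor <;> ext i <;> fin_cases i <;> simp <;> linarith
  · simp [hQ, Fin.sum_univ_two]
    ring

/-- The case `c ≠ 0` of `quadSignature_of_unique_relation`. -/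
theorem quadSignature_of_unique_relation_of_ne_zero (hQ : ∀ t, Q t = u t * v t - w t ^ 2)
    {a b c : ℝ} (hc : c ≠ 0) (hrel : ∀ t, a * u t + b * w t + c * v t = 0)
    (huniq : ∀ a' b' c' : ℝ, (∀ t, a' * u t + b' * w t + c' * v t = 0) →
      ∃ s, a' = s * a ∧ b' = s * b ∧ c' = s * c) :
    (0 < b ^ 2 - 4 * a * c → quadSignature Q = (1, 1, m - 2)) ∧
      (b ^ 2 - 4 * a * c < 0 → quadSignature Q = (0, 2, m - 2)) := by
  have hind : ∀ r : ℝ, r ≠ 0 → ∀ p q : ℝ, (∀ t, p * ((r / (2 * c)) • u) t +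
      q * (w + (b / (2 * c)) • u) t = 0) → p = 0 ∧ q = 0 := by
    intro r hr p q h
    obtain ⟨s, h1, h2, h3⟩ := huniq (p * (r / (2 * c)) + q * (b / (2 * c))) q 0 fun t => by
      have := h t
      simp only [LinearMap.add_apply, LinearMap.smul_apply, smul_eq_mul] at this
      linear_combination this
    have hs : s = 0 := by simpa [hc] using h3
    rw [hs, zero_mul] at h1 h2
    rw [h2, zero_mul, add_zero] at h1
    have : r / (2 * c) ≠ 0 := by positivity
    exact ⟨by simpa [this] using h1, h2⟩
  constructor <;> intro hd
  · refine quadSignature_of_sq_sub_sq _ _ (hind √(b ^ 2 - 4 * a * c) (by positivity)) fun t => ?_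
    rw [hQ, mul_sub_sq_of_relation u w v hc hrel]
    simp only [LinearMap.add_apply, LinearMap.smul_apply, smul_eq_mul]
    rw [show √(b ^ 2 - 4 * a * c) / (2 * c) * u t = √(b ^ 2 - 4 * a * c) * (u t / (2 * c)) by ring,
      mul_pow _ (u t / (2 * c)), Real.sq_sqrt hd.le]
  · have hd' : 0 < -(b ^ 2 - 4 * a * c) := by linarith
    refine quadSignature_of_neg_sq_sub_sq _ _
      (hind √(-(b ^ 2 - 4 * a * c)) (Real.sqrt_pos.mpr hd').ne') fun t => ?_
    rw [hQ, mul_sub_sq_of_relation u w v hc hrel]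
    simp only [LinearMap.add_apply, LinearMap.smul_apply, smul_eq_mul]
    rw [show √(-(b ^ 2 - 4 * a * c)) / (2 * c) * u t =
      √(-(b ^ 2 - 4 * a * c)) * (u t / (2 * c)) by ring,
      mul_pow _ (u t / (2 * c)), Real.sq_sqrt hd'.le]
    ring

/-- If all linear relations between `u, w, v` are multiples of a single one, the sign of its
discriminant determines the signature of `u v - w²`. -/
theorem quadSignature_of_unique_relation (hQ : ∀ t, Q t = u t * v t - w t ^ 2) {a b c : ℝ}
    (hrel : ∀ t, a * u t + b * w t + c * v t = 0)
    (huniq : ∀ a' b' c' : ℝ, (∀ t, a' * u t + b' * w t + c' * v t = 0) →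
      ∃ s, a' = s * a ∧ b' = s * b ∧ c' = s * c) :
    (0 < b ^ 2 - 4 * a * c → quadSignature Q = (1, 1, m - 2)) ∧
      (b ^ 2 - 4 * a * c < 0 → quadSignature Q = (0, 2, m - 2)) := by
  by_cases hc : c = 0
  · by_cases ha : a = 0
    · subst hc ha
      refine ⟨fun hd => ?_, fun hd => absurd hd (by simp; positivity)⟩
      have hb : b ≠ 0 := by rintro rfl; simp at hd
      have hw : ∀ t, w t = 0 := fun t => by simpa [hb] using hrel t
      refine quadSignature_of_sq_sub_sq ((1 / 2 : ℝ) • (u + v)) ((1 / 2 : ℝ) • (u - v))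
        (fun p q h => ?_) (fun t => ?_)
      · obtain ⟨s, h1, -, h3⟩ := huniq ((p + q) / 2) 0 ((p - q) / 2) fun t => by
          have := h t
          simp at this
          linear_combination this
        constructor <;> linarith
      · simp [hQ, hw]
        ring
    · obtain ⟨h1, h2⟩ := quadSignature_of_unique_relation_of_ne_zero (Q := Q) (u := v) (w := w)
        (v := u) (a := c) (b := b) (c := a)
        (fun t => by rw [hQ, mul_comm]) ha (fun t => by linear_combination hrel t)
        (fun a' b' c' h => by
          obtain ⟨s, h1, h2, h3⟩ := huniq c' b' a' fun t => by linear_combination h t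
          exact ⟨s, h3, h2, h1⟩)
      exact ⟨fun h => h1 (by linarith), fun h => h2 (by linarith)⟩
  · exact quadSignature_of_unique_relation_of_ne_zero hQ hc hrel huniq

end Signature

/-! ### Pyramids -/

section Pyramid

variable {N m : ℕ} {A : Matrix (Fin 3) (Fin N) ℝ} {B : Matrix (Fin N) (Fin m) ℝ}

/-- A planar pyramid: all points other than one are zeros of a nonconstant affine function. -/
theorem isPyramid_iff : IsPyramid (n := 2) A ↔
    ∃ (j : Fin N) (α β γ : ℝ), ¬ (α = 0 ∧ β = 0) ∧
      ∀ k, ¬ (A 1 k = A 1 j ∧ A 2 k = A 2 j) → α * A 1 k + β * A 2 k + γ = 0 := by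
  have hcol : ∀ k j, (hatMatrix (n := 2) A).col k = (hatMatrix (n := 2) A).col j ↔
      A 1 k = A 1 j ∧ A 2 k = A 2 j := fun k j => by
    simp only [funext_iff, Fin.forall_fin_two]
    rfl
  refine exists_congr fun j => ?_
  simp only [ne_eq, hcol]
  constructor
  · rintro ⟨S, hS, hk⟩
    rcases S.eq_bot_or_nonempty with rfl | ⟨z, hz⟩
    · -- The empty subspace is proper; then all points coincide, and any line serves.
      exact ⟨1, 0, 0, by simp, fun k h => absurd (hk k h) (AffineSubspace.notMem_bot _ _ _)⟩
    · have hdir : S.direction < ⊤ := by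
        rw [lt_top_iff_ne_top, ne_eq, AffineSubspace.direction_eq_top_iff_of_nonempty ⟨z, hz⟩]
        exact hS
      obtain ⟨φ, hφ, hle⟩ := S.direction.exists_le_ker_of_lt_top hdir
      have key : ∀ x : Fin 2 → ℝ, φ x = φ (Pi.single 0 1) * x 0 + φ (Pi.single 1 1) * x 1 := by
        intro x
        have hx : x = x 0 • Pi.single 0 1 + x 1 • Pi.single 1 1 := by
          ext i; fin_cases i <;> simp
        conv_lhs => rw [hx]
        simp [mul_comm]
      refine ⟨φ (Pi.single 0 1), φ (Pi.single 1 1), -φ z, fun h => hφ ?_, fun k h => ?_⟩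
      · ext x
        fin_cases x <;> simp [h]
      · have h1 : φ ((hatMatrix (n := 2) A).col k -ᵥ z) = 0 :=
          hle (AffineSubspace.vsub_mem_direction (hk k h) hz)
        rw [vsub_eq_sub, map_sub, key (Matrix.col _ _)] at h1
        exact h1
  · rintro ⟨α, β, γ, h0, hk⟩
    refine ⟨{ carrier := {x | α * x 0 + β * x 1 + γ = 0}
              smul_vsub_vadd_mem' := fun c x y z hx hy hz => ?_ }, fun htop => h0 ?_, hk⟩
    · simp only [Set.mem_ofPred_eq, vsub_eq_sub, vadd_eq_add, Pi.add_apply, Pi.smul_apply,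
        Pi.sub_apply, smul_eq_mul] at *
      linear_combination c * hx - c * hy + hz
    · have hmem : ∀ x : Fin 2 → ℝ, α * x 0 + β * x 1 + γ = 0 := fun x => by
        have : x ∈ (⊤ : AffineSubspace ℝ (Fin 2 → ℝ)) := AffineSubspace.mem_top _ _ _
        rwa [← htop] at this
      have h1 := hmem ![0, 0]
      have h2 := hmem ![1, 0]
      have h3 := hmem ![0, 1]
      simp at h1 h2 h3
      constructor <;> linarith

/-- If multiplication by `ℓ = p x + q y` preserves the affine functions on the configuration, the
configuration is a pyramid. -/
theorem isPyramid_of_relations (hones : ∀ k, A 0 k = 1) (hB : IsGaleDual (n := 2) A B) {p q : ℝ}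
    (hpq : ¬ (p = 0 ∧ q = 0)) (h1 : ∀ t, p * momentXX A B t + q * momentXY A B t = 0)
    (h2 : ∀ t, p * momentXY A B t + q * momentYY A B t = 0) : IsPyramid (n := 2) A := by
  obtain ⟨d₁, e₁, f₁, h1⟩ := (moment_relation_iff hones hB p q 0).mp fun t => by
    linear_combination h1 t
  obtain ⟨d₂, e₂, f₂, h2⟩ := (moment_relation_iff hones hB 0 p q).mp fun t => by
    linear_combination h2 t
  have hn : p ^ 2 + q ^ 2 ≠ 0 := fun h =>
    hpq ⟨by nlinarith [sq_nonneg p, sq_nonneg q], by nlinarith [sq_nonneg p, sq_nonneg q]⟩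
  have hn' : 0 < p ^ 2 + q ^ 2 := by positivity
  -- Orthogonal coordinates `X = p x + q y`, `Y = p y - q x`.
  set X : Fin N → ℝ := fun k => p * A 1 k + q * A 2 k with hX
  set Y : Fin N → ℝ := fun k => p * A 2 k - q * A 1 k with hY
  have hx : ∀ k, A 1 k = (p * X k - q * Y k) / (p ^ 2 + q ^ 2) := fun k => by
    simp only [hX, hY]; field_simp; ring
  have hy : ∀ k, A 2 k = (q * X k + p * Y k) / (p ^ 2 + q ^ 2) := fun k => by
    simp only [hX, hY]; field_simp; ring
  have hsame : ∀ k j, X k = X j → Y k = Y j → A 1 k = A 1 j ∧ A 2 k = A 2 j := fun k j h h' =>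
    ⟨by rw [hx, hx j, h, h'], by rw [hy, hy j, h, h']⟩
  have hex : ∀ P Q R : ℝ, ∃ d e f : ℝ,
      ∀ k, P * A 1 k + Q * A 2 k + R = d * X k + e * Y k + f := fun P Q R =>
    ⟨(P * p + Q * q) / (p ^ 2 + q ^ 2), (Q * p - P * q) / (p ^ 2 + q ^ 2), R, fun k => by
      rw [hx, hy]; field_simp; ring⟩
  obtain ⟨d, e, f, hXX⟩ : ∃ d e f : ℝ, ∀ k, X k ^ 2 = d * X k + e * Y k + f := by
    obtain ⟨d, e, f, h⟩ := hex (-(p * d₁ + q * d₂)) (-(p * e₁ + q * e₂)) (-(p * f₁ + q * f₂))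
    refine ⟨d, e, f, fun k => ?_⟩
    rw [← h]
    simp only [hX]
    linear_combination p * h1 k + q * h2 k
  obtain ⟨d', e', f', hXY⟩ : ∃ d e f : ℝ, ∀ k, X k * Y k = d * X k + e * Y k + f := by
    obtain ⟨d, e, f, h⟩ := hex (-(p * d₂ - q * d₁)) (-(p * e₂ - q * e₁)) (-(p * f₂ - q * f₁))
    refine ⟨d, e, f, fun k => ?_⟩
    rw [← h]
    simp only [hX, hY]
    linear_combination p * h2 k - q * h1 k
  have hnonconst : ∀ r s l : ℝ, (∀ k, r * X k + s * Y k + l = 0) → r = 0 ∧ s = 0 := by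
    intro r s l h
    obtain ⟨h3, h4, -⟩ := affine_eq_zero hones hB (d := r * p - s * q) (e := r * q + s * p)
      (f := l) fun k => by have := h k; simp only [hX, hY] at this; linear_combination this
    constructor
    · have : r * (p ^ 2 + q ^ 2) = 0 := by linear_combination p * h3 + q * h4
      simpa [hn] using this
    · have : s * (p ^ 2 + q ^ 2) = 0 := by linear_combination p * h4 - q * h3
      simpa [hn] using this
  -- It suffices to find the apex and the line in the coordinates `X`, `Y`.
  suffices h : ∃ (j : Fin N) (r s l : ℝ), ¬ (r = 0 ∧ s = 0) ∧
      ∀ k, ¬ (X k = X j ∧ Y k = Y j) → r * X k + s * Y k + l = 0 by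
    obtain ⟨j, r, s, l, h0, hk⟩ := h
    refine isPyramid_iff.mpr ⟨j, r * p - s * q, r * q + s * p, l, fun ⟨h3, h4⟩ => h0 ⟨?_, ?_⟩,
      fun k hkj => ?_⟩
    · have : r * (p ^ 2 + q ^ 2) = 0 := by linear_combination p * h3 + q * h4
      simpa [hn] using this
    · have : s * (p ^ 2 + q ^ 2) = 0 := by linear_combination p * h4 - q * h3
      simpa [hn] using this
    · have := hk k fun h => hkj (hsame k j h.1 h.2)
      simp only [hX, hY] at this
      linear_combination this
  by_cases he : e = 0
  · -- `X` takes at most two values, and over one different from `e'` there is a single point.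
    obtain ⟨j, hj⟩ : ∃ j, X j ≠ e' := by
      by_contra! h
      exact one_ne_zero (hnonconst 1 0 (-e') fun k => by rw [h k]; ring).1
    refine ⟨j, 1, 0, X j - d, by simp, fun k hk => ?_⟩
    have hne : X k - X j ≠ 0 := fun h => by
      have hXk : X k = X j := by linarith
      refine hk ⟨hXk, ?_⟩
      have : (X j - e') * (Y k - Y j) = 0 := by
        have := hXY k
        rw [hXk] at this
        linear_combination this - hXY j
      have := (mul_eq_zero.mp this).resolve_left (sub_ne_zero.mpr hj)
      linarith
    have : (X k - X j) * (1 * X k + 0 * Y k + (X j - d)) = 0 := by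
      subst he
      linear_combination hXX k - hXX j
    exact (mul_eq_zero.mp this).resolve_left hne
  · -- `Y` is a quadratic polynomial in `X`, and `X` is a root of a monic cubic polynomial; removing
    -- one root of it leaves a quadratic relation for `X`, which is an affine relation for `X`, `Y`.
    obtain ⟨j⟩ : Nonempty (Fin N) := by
      by_contra h
      rw [not_nonempty_iff] at h
      exact one_ne_zero (hnonconst 1 0 0 fun k => h.elim k).1
    have hcubic : ∀ k, X k ^ 3 + (-d - e') * X k ^ 2 + (e' * d - f - e * d') * X k +
        (e' * f - e * f') = 0 := fun k => by
      linear_combination (X k - e') * hXX k + e * hXY k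
    -- The line is `g(X) / (X - X_j) = 0`, for the cubic `g`, with `X²` replaced by `d X + e Y + f`.
    refine ⟨j, X j - e', e, f + (X j ^ 2 + (-d - e') * X j + (e' * d - f - e * d')),
      fun h => he h.2, fun k hk => ?_⟩
    have hne : X k - X j ≠ 0 := fun h => by
      have hXk : X k = X j := by linarith
      refine hk ⟨hXk, ?_⟩
      have : e * (Y k - Y j) = 0 := by
        have := hXX k
        rw [hXk] at this
        linear_combination hXX j - this
      have := (mul_eq_zero.mp this).resolve_left he
      linarith
    have h3 : (X k - X j) * (X k ^ 2 + (X j - d - e') * X k +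
        (X j ^ 2 + (-d - e') * X j + (e' * d - f - e * d'))) = 0 := by
      linear_combination hcubic k - hcubic j
    linear_combination (mul_eq_zero.mp h3).resolve_left hne - hXX k

/-- If the points other than the apex `z_j` lie on the line `ℓ + γ = 0` with `ℓ = p x + q y`, then
`(x - x_j) (ℓ + γ)` and `(y - y_j) (ℓ + γ)` vanish on the configuration. -/
theorem exists_relations_of_isPyramid (hones : ∀ k, A 0 k = 1) (hB : IsGaleDual (n := 2) A B)
    (h : IsPyramid (n := 2) A) : ∃ p q : ℝ, ¬ (p = 0 ∧ q = 0) ∧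
      (∀ t, p * momentXX A B t + q * momentXY A B t = 0) ∧
      ∀ t, p * momentXY A B t + q * momentYY A B t = 0 := by
  obtain ⟨j, α, β, γ, h0, hk⟩ := isPyramid_iff.mp h
  refine ⟨α, β, h0, fun t => ?_, fun t => ?_⟩
  · have := (moment_relation_iff hones hB α β 0).mpr ⟨γ - α * A 1 j, -β * A 1 j, -γ * A 1 j,
      fun k => ?_⟩ t
    · linear_combination this
    · have : (A 1 k - A 1 j) * (α * A 1 k + β * A 2 k + γ) = 0 := by
        by_cases hkj : A 1 k = A 1 j ∧ A 2 k = A 2 j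
        · simp [hkj.1]
        · simp [hk k hkj]
      linear_combination this
  · have := (moment_relation_iff hones hB 0 α β).mpr ⟨-α * A 2 j, γ - β * A 2 j, -γ * A 2 j,
      fun k => ?_⟩ t
    · linear_combination this
    · have : (A 2 k - A 2 j) * (α * A 1 k + β * A 2 k + γ) = 0 := by
        by_cases hkj : A 1 k = A 1 j ∧ A 2 k = A 2 j
        · simp [hkj.2]
        · simp [hk k hkj]
      linear_combination this

/-- A pyramid lies on two parallel lines, one of them through its apex. -/
theorem IsPyramid.inRealParabola (h : IsPyramid (n := 2) A) : InRealParabola A := by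
  obtain ⟨j, α, β, γ, h0, hk⟩ := isPyramid_iff.mp h
  refine ⟨⟨α ^ 2, 2 * α * β, β ^ 2, γ * α - α * (α * A 1 j + β * A 2 j),
    γ * β - β * (α * A 1 j + β * A 2 j), -γ * (α * A 1 j + β * A 2 j), by
      rintro ⟨h1, -, h3⟩; exact h0 ⟨by simpa using h1, by simpa using h3⟩⟩, ?_, fun k => ?_⟩
  · simp only [ConicEq.disc]; ring
  · have : (α * (A 1 k - A 1 j) + β * (A 2 k - A 2 j)) * (α * A 1 k + β * A 2 k + γ) = 0 := by
      by_cases hkj : A 1 k = A 1 j ∧ A 2 k = A 2 j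
      · simp [hkj.1, hkj.2]
      · simp [hk k hkj]
    simp only [ConicEq.eval]
    linear_combination this

theorem quadSignature_of_isPyramid (hones : ∀ k, A 0 k = 1) (hB : IsGaleDual (n := 2) A B)
    (h : IsPyramid (n := 2) A) : quadSignature (cuspidalQuadForm A B) = (0, 0, m) := by
  obtain ⟨p, q, h0, h1, h2⟩ := exists_relations_of_isPyramid hones hB h
  refine quadSignature_eq_of_squares (p := 0) (q := 0) _ ![] ![]
    (fun _ _ _ => ⟨Subsingleton.elim _ _, Subsingleton.elim _ _⟩) fun t => ?_
  rw [cuspidalQuadForm_apply]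
  simp only [Finset.univ_eq_empty, Finset.sum_empty, sub_zero]
  have h1 := h1 t
  have h2 := h2 t
  by_cases hp : p = 0
  · have hq : q ≠ 0 := fun hq => h0 ⟨hp, hq⟩
    simp only [hp, zero_mul, zero_add, mul_eq_zero, hq, false_or] at h1 h2
    simp [h1, h2]
  · have : p * (momentXX A B t * momentYY A B t - momentXY A B t ^ 2) = 0 := by
      linear_combination momentYY A B t * h1 - momentXY A B t * h2
    exact (mul_eq_zero.mp this).resolve_left hp

end Pyramid

/-! ### Signatures for configurations on conics -/

section Conics

variable {N m : ℕ} {A : Matrix (Fin 3) (Fin N) ℝ} {B : Matrix (Fin N) (Fin m) ℝ}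

theorem moment_relation_of_onRealConic (hones : ∀ k, A 0 k = 1) (hB : IsGaleDual (n := 2) A B)
    {C : ConicEq ℝ} (hC : OnRealConic A C) (t : Fin m → ℝ) :
    C.a * momentXX A B t + C.b * momentXY A B t + C.c * momentYY A B t = 0 :=
  (moment_relation_iff hones hB _ _ _).mpr ⟨C.d, C.e, C.f, hC⟩ t

theorem inParabola_of_complex (C : ConicEq ℂ) (hd : C.disc = 0)
    (hC : ∀ k, C.eval ((A 1 k : ℝ) : ℂ) ((A 2 k : ℝ) : ℂ) = 0) :
    InRealParabola A ∨ InNonRealParabola A := by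
  by_cases hr : C.IsReal
  · left
    obtain ⟨z, R, ha, hb, hc, hd', he, hf⟩ := hr
    have hz : z ≠ 0 := by
      rintro rfl
      exact C.quadratic_part_ne_zero ⟨by simpa using ha, by simpa using hb, by simpa using hc⟩
    refine ⟨R, ?_, fun k => ?_⟩
    · have : z ^ 2 * ((R.disc : ℝ) : ℂ) = 0 := by
        rw [← hd]
        simp only [ConicEq.disc, ha, hb, hc]
        push_cast
        ring
      simpa [hz] using this
    · have : z * ((R.eval (A 1 k) (A 2 k) : ℝ) : ℂ) = 0 := by
        rw [← hC k]
        simp only [ConicEq.eval, ha, hb, hc, hd', he, hf]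
        push_cast
        ring
      exact_mod_cast (mul_eq_zero.mp this).resolve_left hz
  · exact Or.inr ⟨C, hd, hr, hC⟩

/-- A configuration on no parabola lies on at most one conic up to proportional quadratic parts,
once it lies on a conic of nonzero discriminant: in a pencil of conics some complex member has
discriminant zero. -/
theorem proportional_of_not_inParabola (hrp : ¬ InRealParabola A) (hnp : ¬ InNonRealParabola A)
    {C : ConicEq ℝ} (hC : OnRealConic A C) (hdisc : C.disc ≠ 0) {a b c d e f : ℝ}
    (h : ∀ k, a * A 1 k ^ 2 + b * A 1 k * A 2 k + c * A 2 k ^ 2 +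
      d * A 1 k + e * A 2 k + f = 0) :
    ∃ s, a = s * C.a ∧ b = s * C.b ∧ c = s * C.c := by
  -- The discriminant of `z C + C'`, for the second conic `C'`, is quadratic in `z`.
  obtain ⟨z, hz⟩ : ∃ z : ℂ, (C.disc : ℂ) * (z * z) +
      ((2 * C.b * b - 4 * C.a * c - 4 * a * C.c : ℝ) : ℂ) * z +
      ((b ^ 2 - 4 * a * c : ℝ) : ℂ) = 0 := by
    refine exists_quadratic_eq_zero (by exact_mod_cast hdisc) ?_
    exact IsAlgClosed.exists_eq_mul_self _
  by_cases h0 : z * C.a + a = 0 ∧ z * C.b + b = 0 ∧ z * C.c + c = 0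
  · refine ⟨-z.re, ?_, ?_, ?_⟩
    · have := congrArg Complex.re h0.1
      simp at this
      linarith
    · have := congrArg Complex.re h0.2.1
      simp at this
      linarith
    · have := congrArg Complex.re h0.2.2
      simp at this
      linarith
  · let C' : ConicEq ℂ := ⟨z * C.a + a, z * C.b + b, z * C.c + c, z * C.d + d,
      z * C.e + e, z * C.f + f, h0⟩
    have hd' : C'.disc = 0 := by
      rw [← hz]
      simp only [ConicEq.disc, C']
      push_cast
      ring
    have hC' : ∀ k, C'.eval ((A 1 k : ℝ) : ℂ) ((A 2 k : ℝ) : ℂ) = 0 := fun k => by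
      have h1 : ((C.eval (A 1 k) (A 2 k) : ℝ) : ℂ) = 0 := by rw [hC k]; simp
      have h2 : ((a * A 1 k ^ 2 + b * A 1 k * A 2 k + c * A 2 k ^ 2 +
        d * A 1 k + e * A 2 k + f : ℝ) : ℂ) = 0 := by rw [h k]; simp
      simp only [ConicEq.eval, C'] at h1 ⊢
      push_cast at h1 h2
      linear_combination z * h1 + h2
    exact ((inParabola_of_complex C' hd' hC').elim hrp hnp).elim

theorem quadSignature_of_onRealConic (hones : ∀ k, A 0 k = 1) (hB : IsGaleDual (n := 2) A B)
    (hrp : ¬ InRealParabola A) (hnp : ¬ InNonRealParabola A) {C : ConicEq ℝ}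
    (hC : OnRealConic A C) (hdisc : C.disc ≠ 0) :
    (0 < C.disc → quadSignature (cuspidalQuadForm A B) = (1, 1, m - 2)) ∧
      (C.disc < 0 → quadSignature (cuspidalQuadForm A B) = (0, 2, m - 2)) :=
  quadSignature_of_unique_relation (cuspidalQuadForm_apply A B)
    (moment_relation_of_onRealConic hones hB hC) fun a' b' c' h => by
      obtain ⟨d, e, f, h⟩ := (moment_relation_iff hones hB a' b' c').mp h
      exact proportional_of_not_inParabola hrp hnp hC hdisc h

theorem quadSignature_of_not_inConic (hones : ∀ k, A 0 k = 1) (hB : IsGaleDual (n := 2) A B)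
    (hrp : ¬ InRealParabola A) (hh : ¬ InHyperbola A) (he : ¬ InEllipse A) :
    quadSignature (cuspidalQuadForm A B) = (1, 2, m - 3) := by
  refine quadSignature_of_independent (cuspidalQuadForm_apply A B) fun a b c h => ?_
  by_contra h0
  obtain ⟨d, e, f, h⟩ := (moment_relation_iff hones hB a b c).mp h
  let C : ConicEq ℝ := ⟨a, b, c, d, e, f, h0⟩
  rcases lt_trichotomy C.disc 0 with hd | hd | hd
  · exact he ⟨C, hd, h⟩
  · exact hrp ⟨C, hd, h⟩
  · exact hh ⟨C, hd, h⟩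

theorem quadSignature_of_inRealParabola (hones : ∀ k, A 0 k = 1) (hB : IsGaleDual (n := 2) A B)
    (hpyr : ¬ IsPyramid (n := 2) A) (h : InRealParabola A) :
    quadSignature (cuspidalQuadForm A B) = (0, 1, m - 1) := by
  obtain ⟨C, hd, hC⟩ := h
  obtain ⟨l, hl, hz⟩ := exists_neg_square_of_parabola (momentXX A B) (momentXY A B)
    (momentYY A B) C.quadratic_part_ne_zero hd (moment_relation_of_onRealConic hones hB hC)
  refine quadSignature_of_neg_sq l (fun h0 => hpyr ?_) fun t => by
    rw [cuspidalQuadForm_apply, hl]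
  obtain ⟨p, q, hpq, h1, h2⟩ := hz h0
  exact isPyramid_of_relations hones hB hpq h1 h2

/-- A complex conic through the configuration whose quadratic part is proportional to a real one is
real: after rescaling, the imaginary part of its equation is affine and vanishes on the
configuration. -/
theorem isReal_of_quadratic_part_real (hones : ∀ k, A 0 k = 1) (hB : IsGaleDual (n := 2) A B)
    {C : ConicEq ℂ} (hC : ∀ k, C.eval ((A 1 k : ℝ) : ℂ) ((A 2 k : ℝ) : ℂ) = 0) {z : ℂ}
    {a b c : ℝ} (ha : C.a = z * a) (hb : C.b = z * b) (hc : C.c = z * c) : C.IsReal := by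
  have h0 : ¬ (a = 0 ∧ b = 0 ∧ c = 0) := by
    rintro ⟨rfl, rfl, rfl⟩
    exact C.quadratic_part_ne_zero ⟨by simpa using ha, by simpa using hb, by simpa using hc⟩
  have hz : z ≠ 0 := by
    rintro rfl
    exact C.quadratic_part_ne_zero ⟨by simpa using ha, by simpa using hb, by simpa using hc⟩
  obtain ⟨d, hd⟩ : ∃ d, C.d = z * d := ⟨C.d / z, by field_simp⟩
  obtain ⟨e, he⟩ : ∃ e, C.e = z * e := ⟨C.e / z, by field_simp⟩
  obtain ⟨f, hf⟩ : ∃ f, C.f = z * f := ⟨C.f / z, by field_simp⟩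
  have h : ∀ k, (a : ℂ) * (A 1 k : ℂ) ^ 2 + b * (A 1 k : ℂ) * (A 2 k : ℂ) +
      c * (A 2 k : ℂ) ^ 2 + d * (A 1 k : ℂ) + e * (A 2 k : ℂ) + f = 0 := fun k => by
    have h1 : z * ((a : ℂ) * (A 1 k : ℂ) ^ 2 + b * (A 1 k : ℂ) * (A 2 k : ℂ) +
      c * (A 2 k : ℂ) ^ 2 + d * (A 1 k : ℂ) + e * (A 2 k : ℂ) + f) = 0 := by
      rw [← hC k]
      simp only [ConicEq.eval, ha, hb, hc, hd, he, hf]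
      ring
    exact (mul_eq_zero.mp h1).resolve_left hz
  obtain ⟨hd', he', hf'⟩ := affine_eq_zero hones hB (d := d.im) (e := e.im) (f := f.im)
    fun k => by
      have := congrArg Complex.im (h k)
      simpa [pow_two] using this
  refine ⟨z, ⟨a, b, c, d.re, e.re, f.re, h0⟩, ha, hb, hc, ?_, ?_, ?_⟩
  · rw [hd]; congr 1; exact Complex.ext (by simp) (by simp [hd'])
  · rw [he]; congr 1; exact Complex.ext (by simp) (by simp [he'])
  · rw [hf]; congr 1; exact Complex.ext (by simp) (by simp [hf'])

theorem InNonRealParabola.exists_normal_form (hones : ∀ k, A 0 k = 1)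
    (hB : IsGaleDual (n := 2) A B) (h : InNonRealParabola A) :
    ∃ β : ℂ, β.im ≠ 0 ∧ ∃ d e f : ℂ, ∀ k, ((A 1 k : ℂ) + β * (A 2 k : ℂ)) ^ 2 +
      d * (A 1 k : ℂ) + e * (A 2 k : ℂ) + f = 0 := by
  obtain ⟨C, hd, hr, hC⟩ := h
  simp only [ConicEq.disc] at hd
  -- With `a = 0` also `b = 0`, and the quadratic part is a multiple of the real form `y²`.
  have ha : C.a ≠ 0 := by
    intro ha
    have hb : C.b = 0 := by
      rw [ha] at hd
      exact pow_eq_zero_iff two_ne_zero |>.mp (by simpa using hd)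
    exact hr (isReal_of_quadratic_part_real hones hB hC (z := C.c) (a := 0) (b := 0) (c := 1)
      (by simpa using ha) (by simpa using hb) (by simp))
  have hb : C.b = C.a * (2 * (C.b / (2 * C.a))) := by field_simp
  have hc : C.c = C.a * (C.b / (2 * C.a)) ^ 2 := by
    field_simp
    linear_combination -hd
  refine ⟨C.b / (2 * C.a), fun him => hr ?_, C.d / C.a, C.e / C.a, C.f / C.a, fun k => ?_⟩
  · generalize C.b / (2 * C.a) = β at *
    have hβ : β = (β.re : ℂ) := Complex.ext (by simp) (by simp [him])
    refine isReal_of_quadratic_part_real hones hB hC (z := C.a) (a := 1) (b := 2 * β.re)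
      (c := β.re ^ 2) (by simp) ?_ ?_
    · push_cast
      rwa [← hβ]
    · push_cast
      rwa [← hβ]
  · have h1 := hC k
    simp only [ConicEq.eval] at h1
    have h2 : C.a * (((A 1 k : ℂ) + C.b / (2 * C.a) * (A 2 k : ℂ)) ^ 2 +
      C.d / C.a * (A 1 k : ℂ) + C.e / C.a * (A 2 k : ℂ) + C.f / C.a) = 0 := by
      have h3 : C.a * (((A 1 k : ℂ) + C.b / (2 * C.a) * (A 2 k : ℂ)) ^ 2 +
        C.d / C.a * (A 1 k : ℂ) + C.e / C.a * (A 2 k : ℂ) + C.f / C.a) =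
        C.a * (A 1 k : ℂ) ^ 2 + C.a * (2 * (C.b / (2 * C.a))) * (A 1 k : ℂ) * (A 2 k : ℂ) +
        C.a * (C.b / (2 * C.a)) ^ 2 * (A 2 k : ℂ) ^ 2 + C.d * (A 1 k : ℂ) + C.e * (A 2 k : ℂ) +
        C.f := by
        field_simp
        ring
      rw [h3, ← hb, ← hc, h1]
    exact (mul_eq_zero.mp h2).resolve_left ha

theorem quadSignature_of_inNonRealParabola (hones : ∀ k, A 0 k = 1)
    (hB : IsGaleDual (n := 2) A B) (hpyr : ¬ IsPyramid (n := 2) A) (h : InNonRealParabola A) :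
    quadSignature (cuspidalQuadForm A B) = (1, 0, m - 1) := by
  obtain ⟨β, hβ, d, e, f, h⟩ := h.exists_normal_form hones hB
  have hre := (moment_relation_iff hones hB 1 (2 * β.re) (β.re ^ 2 - β.im ^ 2)).mpr
    ⟨d.re, e.re, f.re, fun k => by
      have := congrArg Complex.re (h k)
      simp [pow_two] at this
      linear_combination this⟩
  have him := (moment_relation_iff hones hB 0 (2 * β.im) (2 * β.re * β.im)).mpr
    ⟨d.im, e.im, f.im, fun k => by
      have := congrArg Complex.im (h k)
      simp [pow_two] at this
      linear_combination this⟩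
  have hw : ∀ t, momentXY A B t = -β.re * momentYY A B t := fun t => by
    have : 2 * β.im * (momentXY A B t + β.re * momentYY A B t) = 0 := by
      linear_combination him t
    have := (mul_eq_zero.mp this).resolve_left (by simpa using hβ)
    linarith
  refine quadSignature_of_sq (β.im • momentYY A B) (fun h0 => hpyr ?_) fun t => ?_
  · have hv : ∀ t, momentYY A B t = 0 := fun t => by
      simpa [hβ] using LinearMap.congr_fun h0 t
    exact isPyramid_of_relations hones hB (p := 0) (q := 1) (by simp)
      (fun t => by simp [hw, hv]) (fun t => by simp [hv])
  · rw [cuspidalQuadForm_apply]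
    have := hre t
    simp only [LinearMap.smul_apply, smul_eq_mul]
    rw [hw] at this ⊢
    linear_combination momentYY A B t * this

/-! ### Distinct points on a non-real parabola -/

open Polynomial in
theorem card_le_of_isRoot {N : ℕ} {ζ : Fin N → ℂ} (hζ : Function.Injective ζ) (S : Finset (Fin N))
    {P : ℂ[X]} (hP : P.Monic) (hroot : ∀ k ∈ S, P.IsRoot (ζ k)) : S.card ≤ P.natDegree := by
  rw [← Finset.card_image_of_injective S hζ]
  refine card_le_degree_of_subset_roots fun z hz => ?_
  obtain ⟨k, hk, rfl⟩ := Finset.mem_image.mp (Finset.mem_val.mp hz)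
  exact (mem_roots hP.ne_zero).mpr (hroot k hk)

/-- The equation of a non-real parabola in the complex coordinate `ζ = x + β y`, which separates the
points. -/
theorem InNonRealParabola.exists_conj_form (hones : ∀ k, A 0 k = 1)
    (hB : IsGaleDual (n := 2) A B) (hinj : Function.Injective A.col) (h : InNonRealParabola A) :
    ∃ (β : ℂ) (ζ : Fin N → ℂ), β.im ≠ 0 ∧ Function.Injective ζ ∧
      (∀ k, ζ k = (A 1 k : ℂ) + β * (A 2 k : ℂ)) ∧
      ∃ a b c : ℂ, ∀ k, ζ k ^ 2 + a * ζ k + b * (starRingEnd ℂ) (ζ k) + c = 0 := by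
  obtain ⟨β, hβ, d, e, f, h⟩ := h.exists_normal_form hones hB
  refine ⟨β, fun k => (A 1 k : ℂ) + β * (A 2 k : ℂ), hβ, fun k j hkj => hinj ?_, fun _ => rfl, ?_⟩
  · have him := congrArg Complex.im hkj
    have hre := congrArg Complex.re hkj
    simp [hβ] at him hre
    rw [him] at hre
    ext i
    fin_cases i
    · exact (hones k).trans (hones j).symm
    · exact add_right_cancel hre
    · exact him
  · have hne : β - (starRingEnd ℂ) β ≠ 0 := fun h0 => hβ (by
      have := congrArg Complex.im h0
      simp at this
      linarith)
    refine ⟨(e - d * (starRingEnd ℂ) β) / (β - (starRingEnd ℂ) β),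
      (d * β - e) / (β - (starRingEnd ℂ) β), f, fun k => ?_⟩
    rw [← h k]
    simp only [map_add, map_mul, Complex.conj_ofReal]
    field_simp
    ring

open Polynomial in
/-- A non-real parabola contains at most four points of the real plane: eliminating the conjugate of
`ζ` from its equation and the conjugate equation leaves a monic quartic in `ζ`. -/
theorem InNonRealParabola.card_le_four (hones : ∀ k, A 0 k = 1)
    (hB : IsGaleDual (n := 2) A B) (hinj : Function.Injective A.col) (h : InNonRealParabola A) :
    N ≤ 4 := by
  obtain ⟨-, ζ, -, hζ, -, a, b, c, h⟩ := h.exists_conj_form hones hB hinj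
  set s := starRingEnd ℂ
  -- Multiply the conjugate equation by `b²` and substitute `b ζ̄ = -(ζ² + a ζ + c)`.
  let P : ℂ[X] := (X ^ 2 + C a * X + C c) ^ 2 - C (s a * b) * (X ^ 2 + C a * X + C c) +
    C (b ^ 2 * s b) * X + C (b ^ 2 * s c)
  have hdeg : P.natDegree ≤ 4 := by simp only [P]; compute_degree
  have hP : P.Monic := by simp only [P]; monicity!
  have hcard := card_le_of_isRoot hζ Finset.univ hP fun k _ => by
    have h1 := h k
    have h2 := congrArg s h1
    simp only [map_add, map_mul, map_pow, map_zero, s, Complex.conj_conj] at h2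
    simp only [P, IsRoot, eval_add, eval_sub, eval_mul, eval_pow, eval_X, eval_C]
    linear_combination b ^ 2 * h2 + (ζ k ^ 2 + a * ζ k + c - b * s (ζ k) - s a * b) * h1
  simpa using hcard.trans hdeg

open Polynomial in
/-- On a real line the conjugate of `ζ` is an affine function of `ζ`, so the equation of the
parabola becomes a monic quadratic in `ζ` and at most two points are collinear. -/
theorem InNonRealParabola.card_le_three_of_isPyramid (hones : ∀ k, A 0 k = 1)
    (hB : IsGaleDual (n := 2) A B) (hinj : Function.Injective A.col) (h : InNonRealParabola A)
    (hpyr : IsPyramid (n := 2) A) : N ≤ 3 := by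
  obtain ⟨β, ζ, hβ, hζ, hζdef, a, b, c, h⟩ := h.exists_conj_form hones hB hinj
  obtain ⟨j, p, q, r, h0, hk⟩ := isPyramid_iff.mp hpyr
  set s := starRingEnd ℂ with hs
  -- The line `p x + q y + r = 0` is `μ ζ - s μ * s ζ + r (β - s β) = 0`.
  set μ : ℂ := q - p * s β with hμ
  have hμ0 : μ ≠ 0 := fun h => h0 (by
    have him := congrArg Complex.im h
    have hre := congrArg Complex.re h
    simp [hμ, hs] at him hre
    rcases him with hp | hp
    · exact ⟨hp, by simpa [hp] using hre⟩
    · exact absurd hp hβ)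
  have hsμ0 : s μ ≠ 0 := by simpa [hs] using hμ0
  have hline : ∀ k, k ≠ j → s (ζ k) = (μ * ζ k + r * (β - s β)) / s μ := fun k hkj => by
    have h1 := hk k fun h => hkj (hinj (by
      ext i
      fin_cases i
      · exact (hones k).trans (hones j).symm
      · exact h.1
      · exact h.2))
    have h2 : (p : ℂ) * (A 1 k : ℂ) + q * (A 2 k : ℂ) + r = 0 := by exact_mod_cast h1
    rw [eq_div_iff hsμ0, hζdef]
    simp only [hμ, hs, map_add, map_sub, map_mul, Complex.conj_ofReal, Complex.conj_conj]
    linear_combination ((starRingEnd ℂ) β - β) * h2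
  let P : ℂ[X] := X ^ 2 + C (a + b * μ / s μ) * X + C (b * r * (β - s β) / s μ + c)
  have hdeg : P.natDegree ≤ 2 := by simp only [P]; compute_degree
  have hP : P.Monic := by simp only [P]; monicity!
  have hcard := card_le_of_isRoot hζ (Finset.univ.erase j) hP fun k hkj => by
    have h1 := h k
    rw [hline k (Finset.ne_of_mem_erase hkj)] at h1
    simp only [P, IsRoot, eval_add, eval_mul, eval_pow, eval_X, eval_C]
    linear_combination h1
  have := hcard.trans hdeg
  rw [Finset.card_erase_of_mem (Finset.mem_univ _), Finset.card_univ, Fintype.card_fin] at this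
  omega

end Conics

theorem IsGaleDual.card_eq {n N m : ℕ} {A : Matrix (Fin (n + 1)) (Fin N) ℝ}
    {B : Matrix (Fin N) (Fin m) ℝ} (hB : IsGaleDual A B) : N = m + (n + 1) := by
  have h := A.mulVecLin.finrank_range_add_finrank_ker
  have hker : LinearMap.ker A.mulVecLin = LinearMap.range B.mulVecLin := by
    ext s
    exact hB.2.1 s
  rw [LinearMap.range_eq_top.mpr hB.2.2, finrank_top, hker,
    LinearMap.finrank_range_of_inj hB.1] at h
  simp only [Module.finrank_fin_fun] at h
  omega

/-! ### The classification -/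

theorem mainTheorem2 {N m : ℕ} (A : Matrix (Fin 3) (Fin N) ℝ) (B : Matrix (Fin N) (Fin m) ℝ)
    (hones : ∀ k, A 0 k = 1) (hrank : A.rank = 3) (hB : IsGaleDual (n := 2) A B) :
    (cuspidalForm (n := 2) A B).IsHomogeneous 2 ∧
    (∀ t : Fin m → ℝ,
      cuspidalQuadForm A B t = MvPolynomial.eval t (cuspidalForm (n := 2) A B)) ∧
    (QuadraticForm.toMatrix' (cuspidalQuadForm A B)).rank ≤ 3 ∧
    (quadSignature (cuspidalQuadForm A B) = (0, 0, m) ↔ IsPyramid (n := 2) A) ∧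
    (quadSignature (cuspidalQuadForm A B) = (1, 0, m - 1) ↔
      ¬ IsPyramid (n := 2) A ∧ InNonRealParabola A) ∧
    (Function.Injective A.col → 1 ≤ m →
      (quadSignature (cuspidalQuadForm A B) = (1, 0, 0) ↔ InNonRealParabola A)) ∧
    (quadSignature (cuspidalQuadForm A B) = (0, 1, m - 1) ↔
      ¬ IsPyramid (n := 2) A ∧ InRealParabola A) ∧
    (quadSignature (cuspidalQuadForm A B) = (1, 1, m - 2) ↔
      InHyperbola A ∧ ¬ InRealParabola A ∧ ¬ InNonRealParabola A) ∧
    (quadSignature (cuspidalQuadForm A B) = (0, 2, m - 2) ↔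
      InEllipse A ∧ ¬ InRealParabola A ∧ ¬ InNonRealParabola A) ∧
    (quadSignature (cuspidalQuadForm A B) = (1, 2, m - 3) ↔
      ¬ IsPyramid (n := 2) A ∧ ¬ InNonRealParabola A ∧ ¬ InRealParabola A ∧
        ¬ InHyperbola A ∧ ¬ InEllipse A) := by
  have hcard : N = m + 3 := hB.card_eq
  have hpyr := quadSignature_of_isPyramid hones hB
  have hnrp := quadSignature_of_inNonRealParabola hones hB
  have hrp := quadSignature_of_inRealParabola hones hB
  have hgen := quadSignature_of_not_inConic hones hB
  have hhyp : InHyperbola A → ¬ InRealParabola A → ¬ InNonRealParabola A →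
      quadSignature (cuspidalQuadForm A B) = (1, 1, m - 2) := fun ⟨_, hd, hC⟩ h1 h2 =>
    (quadSignature_of_onRealConic hones hB h1 h2 hC hd.ne').1 hd
  have hell : InEllipse A → ¬ InRealParabola A → ¬ InNonRealParabola A →
      quadSignature (cuspidalQuadForm A B) = (0, 2, m - 2) := fun ⟨_, hd, hC⟩ h1 h2 =>
    (quadSignature_of_onRealConic hones hB h1 h2 hC hd.ne).2 hd
  have hpr : IsPyramid (n := 2) A → InRealParabola A := IsPyramid.inRealParabola
  have hdist : Function.Injective A.col → 1 ≤ m → InNonRealParabola A →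
      m = 1 ∧ ¬ IsPyramid (n := 2) A := fun hinj hm h => by
    have h4 := h.card_le_four hones hB hinj
    exact ⟨by omega, fun hp => by
      have := h.card_le_three_of_isPyramid hones hB hinj hp
      omega⟩
  refine ⟨cuspidalForm_isHomogeneous A B, fun t => rfl,
    rank_toMatrix'_cuspidalQuadForm_le A B, ?_⟩
  generalize quadSignature (cuspidalQuadForm A B) = σ at *
  -- In each case the first two entries of the signature already exclude all other cases, so the
  -- truncated subtractions in the third entries do not matter.
  by_cases c1 : IsPyramid (n := 2) A
  · have hσ := hpyr c1
    have := hpr c1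
    simp only [hσ, Prod.mk.injEq]
    grind
  by_cases c2 : InNonRealParabola A
  · have hσ := hnrp c1 c2
    simp only [hσ, Prod.mk.injEq]
    grind
  by_cases c3 : InRealParabola A
  · have hσ := hrp c1 c3
    simp only [hσ, Prod.mk.injEq]
    grind
  by_cases c4 : InHyperbola A
  · have hσ := hhyp c4 c3 c2
    simp only [hσ, Prod.mk.injEq]
    grind
  by_cases c5 : InEllipse A
  · have hσ := hell c5 c3 c2
    simp only [hσ, Prod.mk.injEq]
    grind
  · have hσ := hgen c3 c4 c5
    simp only [hσ, Prod.mk.injEq]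
    grind
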